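/- Let $k$ be a field of characteristic $0$, contained in an algebraically closed field $K$. By a linear algebraic $k$-group we mean a Zariski closed subgroup $\mathbf{G}$ of some $\mathrm{GL}_n(K)$ that is defined over $k$, i.e. such that the ideal of all polynomials over $K$ in the matrix entries vanishing on $\mathbf{G}$ is generated by polynomials with coefficients in $k$; we write $\mathbf{G}(k)=\mathbf{G}\cap \mathrm{GL}_n(k)$. Connectedness, closure and dimension refer to the Zariski topology. A connected linear algebraic $k$-group $\mathbf{G}$ is called presentable by a product if there are two commuting connected closed $k$-subgroups $\mathbf{G}_1,\mathbf{G}_2$ of $\mathbf{G}$, both of positive dimension, such that the multiplication map $\mathbf{G}_1\times\mathbf{G}_2\to\mathbf{G}$, $(g_1,g_2)\mapsto g_1g_2$, is onto. An abstract group $\Gamma$ is called presentable by a product if there are groups $\Gamma_1,\Gamma_2$ and a homomorphism $\varphi\colon\Gamma_1\times\Gamma_2\to\Gamma$ such that $\varphi(\Gamma_1\times\{1\})$ and $\varphi(\{1\}\times\Gamma_2)$ are infinite and $\varphi(\Gamma_1\times\Gamma_2)$ has finite index in $\Gamma$ (in particular $\Gamma$ is infinite). **Theorem.** Let $\mathbf{G}$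 be a connected linear algebraic $k$-group of positive dimension that is not presentable by a product. Let $\Gamma$ be a subgroup of $\mathbf{G}(k)$ that is Zariski dense in $\mathbf{G}$, i.e. whose Zariski closure is $\mathbf{G}$. Then $\Gamma$ is not presentable by a product. -/

import Mathlib

/-- A group `Γ` is presentable by a product if there is a homomorphism `φ : Γ₁ × Γ₂ → Γ` such that
`φ(Γ₁ × {1})` and `φ({1} × Γ₂)` are infinite and the image of `φ` has finite index in `Γ`.
(This forces `Γ` to be infinite. Letting `Γ₁`, `Γ₂` live in the universe of `Γ` is no restriction,
since they may be replaced by the images of `Γ₁ × {1}` and `{1} × Γ₂`, see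
`GroupPresentableByProduct.of_hom`.) -/
def GroupPresentableByProduct.{u} (Γ : Type u) [Group Γ] : Prop :=
  ∃ (Γ₁ : Type u) (_ : Group Γ₁) (Γ₂ : Type u) (_ : Group Γ₂) (φ : Γ₁ × Γ₂ →* Γ),
    (Set.range fun x : Γ₁ => φ (x, 1)).Infinite ∧
    (Set.range fun y : Γ₂ => φ (1, y)).Infinite ∧
    φ.range.FiniteIndex

/-- The universe of the two factors is irrelevant. -/
theorem GroupPresentableByProduct.of_hom.{u, v, w} {Γ : Type u} [Group Γ]
    {Γ₁ : Type v} [Group Γ₁] {Γ₂ : Type w} [Group Γ₂] (φ : Γ₁ × Γ₂ →* Γ)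
    (h₁ : (Set.range fun x : Γ₁ => φ (x, 1)).Infinite)
    (h₂ : (Set.range fun y : Γ₂ => φ (1, y)).Infinite)
    (h : φ.range.FiniteIndex) : GroupPresentableByProduct Γ := by
  let a : Γ₁ →* Γ := φ.comp (MonoidHom.inl Γ₁ Γ₂)
  let b : Γ₂ →* Γ := φ.comp (MonoidHom.inr Γ₁ Γ₂)
  have hab : ∀ (x : a.range) (y : b.range), Commute (a.range.subtype x) (b.range.subtype y) := by
    rintro ⟨_, x, rfl⟩ ⟨_, y, rfl⟩
    change φ (x, 1) * φ (1, y) = φ (1, y) * φ (x, 1)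
    rw [← map_mul, ← map_mul]
    simp
  refine ⟨a.range, inferInstance, b.range, inferInstance,
    MonoidHom.noncommCoprod a.range.subtype b.range.subtype hab, ?_, ?_, ?_⟩
  · refine h₁.mono ?_
    rintro _ ⟨x, rfl⟩
    exact ⟨⟨a x, x, rfl⟩, by simp [a]⟩
  · refine h₂.mono ?_
    rintro _ ⟨y, rfl⟩
    exact ⟨⟨b y, y, rfl⟩, by simp [b]⟩
  · have := h
    refine Subgroup.finiteIndex_of_le (H := φ.range) ?_
    rintro _ ⟨⟨x, y⟩, rfl⟩
    refine ⟨(⟨a x, x, rfl⟩, ⟨b y, y, rfl⟩), ?_⟩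
    simp [a, b, ← map_mul]

namespace LinAlgGroup

variable {K : Type*} [Field K] {n : ℕ}

/-- The matrix entries of `g ∈ GL_n(K)`, as a point of affine `n²`-space. -/
def coords (g : GL (Fin n) K) : Fin n × Fin n → K := fun ij => (g : Matrix (Fin n) (Fin n) K) ij.1 ij.2

/-- The common zeros in `GL_n(K)` of a set of polynomials in the matrix entries. -/
def zeroSet (P : Set (MvPolynomial (Fin n × Fin n) K)) : Set (GL (Fin n) K) :=
  {g | ∀ p ∈ P, MvPolynomial.eval (coords g) p = 0}

variable (K n) in
/-- The Zariski topology on `GL_n(K)`: the closed sets are the zero sets of sets of polynomials in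
the matrix entries. (The determinant is a unit on `GL_n`, so that allowing its inverse as a further
coordinate gives the same closed sets.) -/
def zariskiTopology : TopologicalSpace (GL (Fin n) K) :=
  TopologicalSpace.ofClosed {S | ∃ P : Set (MvPolynomial (Fin n × Fin n) K), S = zeroSet P}
    ⟨{1}, by ext g; simp [zeroSet]⟩
    (by
      intro A hA
      refine ⟨{p | ∃ P, zeroSet P ∈ A ∧ p ∈ P}, ?_⟩
      ext g
      simp only [Set.mem_sInter]
      constructor
      · rintro h p ⟨P, hP, hp⟩
        exact h _ hP p hp
      · intro h S hS
        obtain ⟨P, rfl⟩ := hA hS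
        exact fun p hp => h p ⟨P, hS, hp⟩)
    (by
      rintro _ ⟨P, rfl⟩ _ ⟨Q, rfl⟩
      refine ⟨{r | ∃ p ∈ P, ∃ q ∈ Q, r = p * q}, ?_⟩
      ext g
      constructor
      · rintro (h | h) _ ⟨p, hp, q, hq, rfl⟩
        · rw [map_mul, h p hp, zero_mul]
        · rw [map_mul, h q hq, mul_zero]
      · intro h
        by_cases hg : g ∈ zeroSet P
        · exact Or.inl hg
        · right
          simp only [zeroSet, Set.mem_ofPred_eq, not_forall] at hg
          obtain ⟨p, hp, hpg⟩ := hg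
          intro q hq
          have := h _ ⟨p, hp, q, hq, rfl⟩
          rw [map_mul] at this
          exact (mul_eq_zero.mp this).resolve_left hpg)

/-- Zariski closed subsets of `GL_n(K)`. -/
def IsZariskiClosed (S : Set (GL (Fin n) K)) : Prop :=
  @IsClosed _ (zariskiTopology K n) S

theorem isZariskiClosed_iff (S : Set (GL (Fin n) K)) :
    IsZariskiClosed S ↔ ∃ P : Set (MvPolynomial (Fin n × Fin n) K), S = zeroSet P := by
  rw [IsZariskiClosed, ← @isOpen_compl_iff _ S (zariskiTopology K n)]
  change Sᶜᶜ ∈ {S | ∃ P : Set (MvPolynomial (Fin n × Fin n) K), S = zeroSet P} ↔ _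
  rw [compl_compl]
  rfl

/-- The Zariski closure of a subset of `GL_n(K)`. -/
def zariskiClosure (S : Set (GL (Fin n) K)) : Set (GL (Fin n) K) :=
  @closure _ (zariskiTopology K n) S

/-- Connectedness in the Zariski topology. -/
def IsZariskiConnected (G : Subgroup (GL (Fin n) K)) : Prop :=
  @IsConnected _ (zariskiTopology K n) (G : Set (GL (Fin n) K))

/-- The dimension of `G`: its Krull dimension in the (induced) Zariski topology. -/
noncomputable def dim (G : Subgroup (GL (Fin n) K)) : WithBot ℕ∞ :=
  @topologicalKrullDim G (TopologicalSpace.induced Subtype.val (zariskiTopology K n))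

/-- A subset of `GL_n(K)` is defined over the subfield `k` of `K` if the ideal of all polynomials
over `K` that vanish on it is generated by polynomials with coefficients in `k`. -/
def IsDefinedOver (k : Type*) [Field k] [Algebra k K] (S : Set (GL (Fin n) K)) : Prop :=
  ∃ P : Set (MvPolynomial (Fin n × Fin n) k),
    MvPolynomial.vanishingIdeal K (coords '' S) =
      Ideal.span (MvPolynomial.map (algebraMap k K) '' P)

/-- Linear algebraic `k`-groups, for `K` an algebraically closed extension of `k`:
Zariski closed subgroups of `GL_n(K)` that are defined over `k`. -/
structure IsAlgebraicGroup (k : Type*) [Field k] [Algebra k K]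
    (G : Subgroup (GL (Fin n) K)) : Prop where
  isZariskiClosed : IsZariskiClosed (G : Set (GL (Fin n) K))
  isDefinedOver : IsDefinedOver k (G : Set (GL (Fin n) K))

/-- The group `G(k)` of `k`-points of `G`: the elements of `G` that are images of elements of
`GL_n(k)`. -/
def points (k : Type*) [Field k] [Algebra k K] (G : Subgroup (GL (Fin n) K)) :
    Subgroup (GL (Fin n) K) :=
  G ⊓ (Matrix.GeneralLinearGroup.map (n := Fin n) (algebraMap k K)).range

/-- A (connected linear algebraic `k`-) group `G` is presentable by a product if there are two
commuting connected closed `k`-subgroups `G₁`, `G₂` of `G` of positive dimensions such that the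
multiplication `G₁ × G₂ → G` is onto. -/
def IsPresentableByProduct (k : Type*) [Field k] [Algebra k K]
    (G : Subgroup (GL (Fin n) K)) : Prop :=
  ∃ G₁ G₂ : Subgroup (GL (Fin n) K),
    G₁ ≤ G ∧ G₂ ≤ G ∧
    IsAlgebraicGroup k G₁ ∧ IsAlgebraicGroup k G₂ ∧
    IsZariskiConnected G₁ ∧ IsZariskiConnected G₂ ∧
    0 < dim G₁ ∧ 0 < dim G₂ ∧
    (∀ g₁ ∈ G₁, ∀ g₂ ∈ G₂, g₁ * g₂ = g₂ * g₁) ∧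
    (∀ g ∈ G, ∃ g₁ ∈ G₁, ∃ g₂ ∈ G₂, g₁ * g₂ = g)

end LinAlgGroup

/-! A presentation of `Γ` gives two infinite commuting subgroups whose product has finite index in
`Γ`. Each contains a finite-index subgroup that is irreducible in the Zariski topology
(`Subgroup.exists_relIndex_ne_zero_isIrreducible`). The closures `H₁`, `H₂` of these are connected,
commute, have positive dimension because they are infinite, and are defined over `k` because they
are closures of sets of `k`-points (`isDefinedOver_closure`). `H₁H₂` contains a finite-index
subgroup of `Γ`, which is dense since `G` is connected (`Subgroup.closure_eq_of_relIndex_ne_zero`).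
By Chevalley, `H₁H₂` is constructible, so it contains a nonempty open subset of the irreducible
group `G`; being a subgroup, it is all of `G` (`exists_mul_eq_of_dense`). So `G` would be
presentable by a product. Multiplication is not jointly continuous for the Zariski topology in
general; the topological part uses only continuous translations and the Noetherian property. -/

section NoetherianGroup

/-! ### Groups with a Noetherian topology and continuous translations -/

open Set Topology TopologicalSpace Pointwise

/-- A dense finite union of locally closed subsets of an irreducible set contains a nonempty open
subset of it. -/
theorem IsIrreducible.exists_isOpen_inter_subset {X : Type*} [TopologicalSpace X] {G : Set X}
    (hG : IsIrreducible G) {ι : Type*} (I : Finset ι) (Z U : ι → Set X)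
    (hZ : ∀ i ∈ I, IsClosed (Z i)) (hU : ∀ i ∈ I, IsOpen (U i))
    (hsub : ⋃ i ∈ I, Z i ∩ U i ⊆ G) (hdense : G ⊆ closure (⋃ i ∈ I, Z i ∩ U i)) :
    ∃ V : Set X, IsOpen V ∧ (G ∩ V).Nonempty ∧ G ∩ V ⊆ ⋃ i ∈ I, Z i ∩ U i := by
  classical
  rw [Finset.closure_biUnion] at hdense
  -- By irreducibility a single piece is already dense in `G`.
  obtain ⟨W, hW, hGW⟩ := isIrreducible_iff_sUnion_isClosed.mp hG
    (I.image fun i => closure (Z i ∩ U i))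
    (by simp) (by simpa using hdense)
  obtain ⟨i, hi, rfl⟩ := Finset.mem_image.mp hW
  have hGZ : G ⊆ Z i := hGW.trans (closure_minimal inter_subset_left (hZ i hi))
  have hsub' : G ∩ U i ⊆ ⋃ i ∈ I, Z i ∩ U i := fun x hx =>
    mem_iUnion₂.mpr ⟨i, hi, hGZ hx.1, hx.2⟩
  refine ⟨U i, hU i hi, ?_, hsub'⟩
  obtain ⟨x, hx⟩ := hG.nonempty
  obtain ⟨y, hy⟩ := closure_nonempty_iff.mp ⟨x, hGW hx⟩
  exact ⟨y, hsub (mem_iUnion₂.mpr ⟨i, hi, hy⟩), hy.2⟩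

variable {X : Type*} [Group X] [TopologicalSpace X] [SeparatelyContinuousMul X]

/-- In a Noetherian space with a group structure whose translations are continuous, the closure of
a subgroup is a subgroup, even if the inversion is not known to be continuous. -/
def Subgroup.noetherianClosure [NoetherianSpace X] (A : Subgroup X) : Subgroup X where
  toSubmonoid := A.toSubmonoid.topologicalClosure
  inv_mem' := by
    set H := A.toSubmonoid.topologicalClosure with hH
    have hcl : IsClosed (H : Set X) := A.toSubmonoid.isClosed_topologicalClosure
    intro h hh
    change h⁻¹ ∈ H
    -- The descending chain of closed sets `h ^ m • H` stabilizes, so `h ^ N = h ^ (N + 1) * x` with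
    -- `x ∈ H`, and `x = h⁻¹`.
    let F : ℕ → Closeds X := fun m => ⟨h ^ m • (H : Set X), hcl.smul _⟩
    obtain ⟨_, ⟨N, rfl⟩, hN⟩ := (wellFounded_lt (α := Closeds X)).has_min (range F) ⟨_, 0, rfl⟩
    have hle : F (N + 1) ≤ F N := by
      rintro _ ⟨x, hx, rfl⟩
      exact ⟨h * x, H.mul_mem hh hx, by simp [pow_succ, mul_assoc]⟩
    have heq : F (N + 1) = F N := by
      by_contra hne
      exact hN _ ⟨N + 1, rfl⟩ (lt_of_le_of_ne hle hne)
    have h1 : h ^ N ∈ F (N + 1) := heq ▸ ⟨1, H.one_mem, by simp⟩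
    obtain ⟨x, hx, hx'⟩ := h1
    have : h * x = 1 := by
      simpa [pow_succ, mul_assoc] using hx'
    rwa [inv_eq_of_mul_eq_one_right this]

theorem Subgroup.le_noetherianClosure [NoetherianSpace X] (A : Subgroup X) :
    A ≤ A.noetherianClosure := fun _ h => _root_.subset_closure h

/-- Translations permute the finitely many irreducible components, so the stabilizer of a component
`Z` through `1` has finite index. It lies in the closed set `Z` and is dense, so `Z` is everything.
-/
theorem irreducibleSpace_of_finiteIndex_dense [NoetherianSpace X]
    (h : ∀ N : Subgroup X, N.FiniteIndex → Dense (N : Set X)) : IrreducibleSpace X := by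
  set Z : Set X := irreducibleComponent 1
  have hmem : ∀ a : X, a • Z ∈ irreducibleComponents X := by
    intro a
    have hZ := irreducibleComponent_mem_irreducibleComponents (1 : X)
    have hirr : ∀ (b : X) (W : Set X), IsIrreducible W → IsIrreducible (b • W) := fun b W hW =>
      hW.image (fun x => b • x) (continuous_const_smul b).continuousOn
    refine ⟨hirr a Z hZ.1, fun W hW hle => ?_⟩
    have hle' : Z ⊆ a⁻¹ • W := by
      rw [subset_smul_set_iff, inv_inv]
      exact hle
    have h3 : a⁻¹ • W ⊆ Z := hZ.2 (hirr a⁻¹ W hW) hle'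
    rw [smul_set_subset_iff_subset_inv_smul_set, inv_inv] at h3
    exact h3
  have hfin : (MulAction.orbit X Z).Finite :=
    NoetherianSpace.finite_irreducibleComponents.subset (by rintro _ ⟨a, rfl⟩; exact hmem a)
  have hidx : (MulAction.stabilizer X Z).FiniteIndex := by
    refine ⟨?_⟩
    rw [MulAction.index_stabilizer]
    have := hfin.to_subtype
    have : Nonempty (MulAction.orbit X Z) := ⟨⟨Z, MulAction.mem_orbit_self Z⟩⟩
    exact (Set.ncard_pos hfin).mpr (MulAction.nonempty_orbit Z) |>.ne'
  have hsub : (MulAction.stabilizer X Z : Set X) ⊆ Z := by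
    intro a ha
    have h1 : a • (1 : X) ∈ a • Z := smul_mem_smul_set mem_irreducibleComponent
    rw [MulAction.mem_stabilizer_iff.mp ha] at h1
    simpa using h1
  have huniv : Z = univ := by
    refine eq_univ_of_univ_subset ?_
    rw [← (h _ hidx).closure_eq]
    exact closure_minimal hsub isClosed_irreducibleComponent
  rw [irreducibleSpace_def, top_eq_univ, ← huniv]
  exact isIrreducible_irreducibleComponent

/-- Take `B` of finite index with minimal closure: all its finite-index subgroups are then dense in
it. This replaces passing to an identity component. -/
theorem Subgroup.exists_relIndex_ne_zero_isIrreducible [NoetherianSpace X] (A : Subgroup X) :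
    ∃ B ≤ A, B.relIndex A ≠ 0 ∧ IsIrreducible (B : Set X) := by
  obtain ⟨_, ⟨B, ⟨hBA, hB⟩, rfl⟩, hmin⟩ := (wellFounded_lt (α := Closeds X)).has_min
    ((fun B : Subgroup X => Closeds.closure (B : Set X)) '' {B | B ≤ A ∧ B.relIndex A ≠ 0})
    ⟨_, A, ⟨le_rfl, by simp⟩, rfl⟩
  refine ⟨B, hBA, hB, ?_⟩
  rw [isIrreducible_iff_irreducibleSpace]
  change IrreducibleSpace B
  have : NoetherianSpace B := NoetherianSpace.set _
  have : SeparatelyContinuousMul B := inferInstanceAs (SeparatelyContinuousMul B.toSubmonoid)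
  refine irreducibleSpace_of_finiteIndex_dense fun N hN => ?_
  have hNB : N.map B.subtype ≤ B := Subgroup.map_subtype_le N
  have hrel : (N.map B.subtype).relIndex B ≠ 0 := by
    rw [Subgroup.relIndex, Subgroup.subgroupOf,
      Subgroup.comap_map_eq_self_of_injective B.subtype_injective]
    exact hN.index_ne_zero
  have hrel' : (N.map B.subtype).relIndex A ≠ 0 := by
    rw [← Subgroup.relIndex_mul_relIndex _ _ _ hNB hBA]
    exact mul_ne_zero hrel hB
  have hle : Closeds.closure (N.map B.subtype : Set X) ≤ Closeds.closure (B : Set X) :=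
    Closeds.gc.monotone_l hNB
  have heq : Closeds.closure (N.map B.subtype : Set X) = Closeds.closure (B : Set X) := by
    by_contra hne
    exact hmin _ ⟨_, ⟨hNB.trans hBA, hrel'⟩, rfl⟩ (lt_of_le_of_ne hle hne)
  have heq' : _root_.closure (Subtype.val '' (N : Set B)) = _root_.closure (B : Set X) :=
    congrArg (fun Z : Closeds X => (Z : Set X)) heq
  intro b
  rw [closure_subtype]
  exact heq' ▸ _root_.subset_closure b.2

/-- A subgroup of finite index in a dense subgroup of a connected group is dense. -/
theorem Subgroup.closure_eq_of_relIndex_ne_zero [NoetherianSpace X] {L Γ : Subgroup X}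
    (hL : L ≤ Γ) (hidx : L.relIndex Γ ≠ 0) (hconn : IsPreconnected (_root_.closure (Γ : Set X))) :
    _root_.closure (L : Set X) = _root_.closure (Γ : Set X) := by
  refine (_root_.closure_mono hL).antisymm ?_
  set D := L.noetherianClosure
  have hDcl : IsClosed (D : Set X) := isClosed_closure
  -- The translate `g • D` depends only on the coset of `g` modulo `L`.
  have hfin : (range fun g : Γ => (g : X) • (D : Set X)).Finite := by
    have : (L.subgroupOf Γ).FiniteIndex := ⟨hidx⟩
    have : Finite (Γ ⧸ L.subgroupOf Γ) := Subgroup.finite_quotient_of_finiteIndex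
    refine (Set.finite_range fun q : Γ ⧸ L.subgroupOf Γ => (q.out : X) • (D : Set X)).subset ?_
    rintro _ ⟨g, rfl⟩
    refine ⟨(g : Γ ⧸ L.subgroupOf Γ), ?_⟩
    obtain ⟨l, hl⟩ := QuotientGroup.mk_out_eq_mul (L.subgroupOf Γ) g
    have hlD : ((l : Γ) : X) ∈ D := L.le_noetherianClosure (Subgroup.mem_subgroupOf.mp l.2)
    dsimp only
    rw [hl, Subgroup.coe_mul, mul_smul, smul_coe_set hlD]
  -- `D` and the union `E` of its other translates are disjoint closed sets covering the closure of
  -- `Γ`; connectedness leaves only `D`.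
  set E : Set X := ⋃₀ ((range fun g : Γ => (g : X) • (D : Set X)) \ {(D : Set X)})
  have hEcl : IsClosed E := by
    simp only [E, sUnion_eq_biUnion]
    refine hfin.sdiff.isClosed_biUnion ?_
    rintro _ ⟨⟨g, rfl⟩, -⟩
    exact hDcl.smul _
  have hcover : _root_.closure (Γ : Set X) ⊆ D ∪ E := by
    refine closure_minimal (fun g hg => ?_) (hDcl.union hEcl)
    by_cases h : g • (D : Set X) = D
    · left
      rw [← h]
      exact ⟨1, D.one_mem, by simp⟩
    · right
      exact ⟨_, ⟨⟨⟨g, hg⟩, rfl⟩, h⟩, 1, D.one_mem, by simp⟩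
  have hdisj : ∀ x ∈ D, x ∉ E := by
    rintro x hx ⟨_, ⟨⟨g, rfl⟩, hg⟩, d, hd, hdx⟩
    refine hg (smul_coe_set ?_)
    have : (g : X) = x * d⁻¹ := by
      rw [← hdx]
      simp
    rw [this]
    exact D.mul_mem hx (D.inv_mem hd)
  intro x hx
  by_contra hxD
  obtain ⟨y, -, hyD, hyE⟩ := isPreconnected_closed_iff.mp hconn D E hDcl hEcl hcover
    ⟨1, _root_.subset_closure Γ.one_mem, D.one_mem⟩
    ⟨x, hx, (hcover hx).resolve_left hxD⟩
  exact hdisj y hyD hyE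

/-- A subgroup of an irreducible group that contains a nonempty open subset is the whole group. -/
theorem Subgroup.le_of_inter_isOpen_subset {G S : Subgroup X} (hG : IsPreirreducible (G : Set X))
    {V : Set X} (hV : IsOpen V) (hne : ((G : Set X) ∩ V).Nonempty)
    (hsub : (G : Set X) ∩ V ⊆ S) : G ≤ S := by
  intro g hg
  obtain ⟨u, huG, huV⟩ := hne
  -- `V` and `g • V` meet inside `G`, which writes `g` as a quotient of two elements of `S`.
  obtain ⟨x, hxG, hxV, v, hv, rfl⟩ := hG V (g • V) hV (hV.smul g) ⟨u, huG, huV⟩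
    ⟨g * u, G.mul_mem hg huG, u, huV, rfl⟩
  have hvG : v ∈ G := (G.mul_mem_cancel_left hg).mp hxG
  exact (S.mul_mem_cancel_right (hsub ⟨hvG, hv⟩)).mp (hsub ⟨hxG, hxV⟩)

end NoetherianGroup

/-! ### The Zariski topology on `GL_n(K)` -/

namespace LinAlgGroup

section Zariski

open Set Topology TopologicalSpace Pointwise MvPolynomial

variable {K : Type*} [Field K] {n : ℕ}

attribute [local instance] zariskiTopology

/-- The point of the spectrum of the polynomial ring in the matrix entries given by `g`. -/
noncomputable def toSpec (g : GL (Fin n) K) : PrimeSpectrum (MvPolynomial (Fin n × Fin n) K) :=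
  ⟨RingHom.ker (eval (coords g)), RingHom.ker_isPrime _⟩

theorem mem_toSpec {g : GL (Fin n) K} {p : MvPolynomial (Fin n × Fin n) K} :
    p ∈ (toSpec g).asIdeal ↔ eval (coords g) p = 0 := Iff.rfl

theorem isClosed_iff_zeroSet {S : Set (GL (Fin n) K)} :
    IsClosed S ↔ ∃ P : Set (MvPolynomial (Fin n × Fin n) K), S = zeroSet P :=
  isZariskiClosed_iff S

/-- Both topologies have zero loci of sets of polynomials as closed sets. This transfers
Noetherianity and constructibility from the spectrum. -/
theorem isInducing_toSpec : IsInducing (toSpec (K := K) (n := n)) := by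
  refine ⟨TopologicalSpace.ext_iff_isClosed.mpr fun S => ?_⟩
  rw [isClosed_induced_iff, isClosed_iff_zeroSet]
  constructor
  · rintro ⟨P, rfl⟩
    exact ⟨_, PrimeSpectrum.isClosed_zeroLocus P, rfl⟩
  · rintro ⟨T, hT, rfl⟩
    obtain ⟨P, rfl⟩ := (PrimeSpectrum.isClosed_iff_zeroLocus T).mp hT
    exact ⟨P, rfl⟩

instance : NoetherianSpace (GL (Fin n) K) := isInducing_toSpec.noetherianSpace

/-- A map whose matrix entries are polynomials in the matrix entries is continuous. -/
theorem continuous_of_coords {F : GL (Fin n) K → GL (Fin n) K}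
    (f : Fin n × Fin n → MvPolynomial (Fin n × Fin n) K)
    (h : ∀ g ij, coords (F g) ij = eval (coords g) (f ij)) : Continuous F := by
  rw [continuous_iff_isClosed]
  intro S hS
  obtain ⟨P, rfl⟩ := isClosed_iff_zeroSet.mp hS
  refine isClosed_iff_zeroSet.mpr ⟨bind₁ f '' P, ?_⟩
  ext g
  have hg : coords (F g) = fun ij => eval (coords g) (f ij) := funext (h g)
  have key : ∀ p, eval (coords g) (bind₁ f p) = eval (coords (F g)) p := by
    intro p
    rw [hg]
    exact eval₂Hom_bind₁ _ _ _ _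
  simp [zeroSet, key]

instance : SeparatelyContinuousMul (GL (Fin n) K) where
  continuous_const_mul {h} :=
    continuous_of_coords (fun ij => ∑ k, C (coords h (ij.1, k)) * X (k, ij.2)) (by
      intro g ij
      simp [coords, Matrix.mul_apply])
  continuous_mul_const {h} :=
    continuous_of_coords (fun ij => ∑ k, X (ij.1, k) * C (coords h (k, ij.2))) (by
      intro g ij
      simp [coords, Matrix.mul_apply])

theorem coords_injective : Function.Injective (coords (K := K) (n := n)) := by
  intro g h hgh
  ext i j
  exact congrFun hgh (i, j)

theorem isClosed_singleton (g : GL (Fin n) K) : IsClosed ({g} : Set (GL (Fin n) K)) := by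
  refine isClosed_iff_zeroSet.mpr ⟨range fun ij => X ij - C (coords g ij), ?_⟩
  ext h
  simp only [zeroSet, mem_singleton_iff, forall_mem_range, mem_ofPred_eq, map_sub, eval_X, eval_C,
    sub_eq_zero]
  exact ⟨fun e => e ▸ fun _ => rfl, fun e => coords_injective (funext e)⟩

instance : T1Space (GL (Fin n) K) := ⟨isClosed_singleton⟩

theorem isClosed_commute (g : GL (Fin n) K) : IsClosed {h : GL (Fin n) K | g * h = h * g} := by
  refine isClosed_iff_zeroSet.mpr ⟨range fun ij : Fin n × Fin n =>
    (∑ k, C (coords g (ij.1, k)) * X (k, ij.2)) - ∑ k, X (ij.1, k) * C (coords g (k, ij.2)), ?_⟩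
  ext h
  have key : ∀ ij : Fin n × Fin n, eval (coords h)
      ((∑ k, C (coords g (ij.1, k)) * X (k, ij.2)) - ∑ k, X (ij.1, k) * C (coords g (k, ij.2))) =
        coords (g * h) ij - coords (h * g) ij := by
    intro ij
    simp [coords, Matrix.mul_apply]
  simp only [zeroSet, forall_mem_range, mem_ofPred_eq, key, sub_eq_zero]
  exact ⟨fun e => e ▸ fun _ => rfl, fun e => coords_injective (funext e)⟩

/-- Centralizers of elements are closed; this is applied to one factor at a time. -/
theorem commute_of_mem_closure {A B : Set (GL (Fin n) K)}
    (h : ∀ a ∈ A, ∀ b ∈ B, a * b = b * a) :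
    ∀ a ∈ closure A, ∀ b ∈ closure B, a * b = b * a := by
  have h1 : ∀ a ∈ A, ∀ b ∈ closure B, a * b = b * a := fun a ha b hb =>
    closure_minimal (h a ha) (isClosed_commute a) hb
  exact fun a ha b hb =>
    (closure_minimal (fun a ha => (h1 a ha b hb).symm) (isClosed_commute b) ha).symm

theorem dim_pos {H : Subgroup (GL (Fin n) K)} (hirr : IsIrreducible (H : Set (GL (Fin n) K)))
    (hinf : (H : Set (GL (Fin n) K)).Infinite) : 0 < dim H := by
  have : IrreducibleSpace H := isIrreducible_iff_irreducibleSpace.mp hirr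
  have : Infinite H := hinf.to_subtype
  change 0 < Order.krullDim (IrreducibleCloseds H)
  rw [Order.krullDim_pos_iff]
  refine ⟨⟨{1}, isIrreducible_singleton, _root_.isClosed_singleton⟩,
    ⟨univ, IrreducibleSpace.isIrreducible_univ _, isClosed_univ⟩, ?_⟩
  refine SetLike.coe_ssubset_coe.mp ((ssubset_univ_iff).mpr fun h => ?_)
  have h' : ({1} : Set H) = univ := h
  exact infinite_univ (h' ▸ finite_singleton (1 : H))

/-! ### Rationality over `k` -/

/-- The closure of a set of `k`-rational matrices is defined over `k`. -/
theorem isDefinedOver_closure {k : Type*} [Field k] [Algebra k K] {A : Set (GL (Fin n) K)}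
    (hA : A ⊆ range (Matrix.GeneralLinearGroup.map (n := Fin n) (algebraMap k K))) :
    IsDefinedOver k (closure A) := by
  refine ⟨{q | map (algebraMap k K) q ∈ vanishingIdeal K (coords '' closure A)}, ?_⟩
  refine le_antisymm (fun p hp => ?_) (Ideal.span_le.mpr (by rintro _ ⟨q, hq, rfl⟩; exact hq))
  classical
  -- Expanding coefficients in a `k`-basis of `K` gives `p = ∑ b i * q i` with `q i` over `k`. At a
  -- `k`-point, `q i` takes the `i`-th coordinate of the value of `p`, so it vanishes whenever `p`
  -- does.
  let b := Module.Basis.ofVectorSpace k K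
  let q : Module.Basis.ofVectorSpaceIndex k K → MvPolynomial (Fin n × Fin n) k := fun i =>
    ∑ m ∈ p.support, monomial m (b.repr (coeff m p) i)
  let s := p.support.biUnion fun m => (b.repr (coeff m p)).support
  have hp_sum : p = ∑ i ∈ s, C (b i) * map (algebraMap k K) (q i) := by
    have : ∀ m ∈ p.support,
        coeff m p = ∑ i ∈ s, b i * algebraMap k K (b.repr (coeff m p) i) := by
      intro m hm
      conv_lhs => rw [← b.linearCombination_repr (coeff m p)]
      rw [Finsupp.linearCombination_apply, Finsupp.sum_of_support_subset (s := s) _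
        (Finset.subset_biUnion_of_mem (fun m => (b.repr (coeff m p)).support) hm) _ (by simp)]
      exact Finset.sum_congr rfl fun i _ => by rw [Algebra.smul_def, mul_comm]
    simp only [q, map_sum, map_monomial, Finset.mul_sum, C_mul_monomial]
    rw [Finset.sum_comm]
    conv_lhs => rw [p.as_sum]
    refine Finset.sum_congr rfl fun m hm => ?_
    rw [← map_sum, ← this m hm]
  have hq : ∀ i, map (algebraMap k K) (q i) ∈ vanishingIdeal K (coords '' closure A) := by
    intro i
    have hsub : A ⊆ zeroSet {map (algebraMap k K) (q i)} := by
      intro g hg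
      obtain ⟨g₀, rfl⟩ := hA hg
      have hc : coords (Matrix.GeneralLinearGroup.map (algebraMap k K) g₀) =
          fun ij => algebraMap k K (coords g₀ ij) := rfl
      have h0 : ∑ m ∈ p.support, coeff m p * ∏ ij, algebraMap k K (coords g₀ ij) ^ m ij = 0 := by
        have := (mem_vanishingIdeal_iff.mp hp) _ (mem_image_of_mem _ (subset_closure hg))
        rwa [aeval_eq_eval, eval_eq', hc] at this
      rintro _ rfl
      have h1 : b.repr (∑ m ∈ p.support, coeff m p * ∏ ij, algebraMap k K (coords g₀ ij) ^ m ij) i =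
          eval (coords g₀) (q i) := by
        simp only [q, map_sum, Finsupp.finsetSum_apply, eval_monomial, Finsupp.prod_fintype _ _
          (fun _ => pow_zero _)]
        refine Finset.sum_congr rfl fun m _ => ?_
        simp only [← map_pow, ← map_prod]
        rw [mul_comm, ← Algebra.smul_def, map_smul, Finsupp.smul_apply, smul_eq_mul, mul_comm]
      rw [h0, map_zero, Finsupp.zero_apply] at h1
      rw [hc, ← Function.comp_def (algebraMap k K), ← map_eval, ← h1, map_zero]
    refine mem_vanishingIdeal_iff.mpr ?_
    rintro _ ⟨g, hg, rfl⟩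
    exact closure_minimal hsub (isClosed_iff_zeroSet.mpr ⟨_, rfl⟩) hg _ rfl
  rw [hp_sum]
  exact Ideal.sum_mem _ fun i _ => Ideal.mul_mem_left _ _ (Ideal.subset_span ⟨q i, hq i, rfl⟩)

/-! ### Products of closed subgroups -/

/-- The product of two closed sets is the preimage of a constructible set. -/
theorem exists_isConstructible_mul_eq_preimage [IsAlgClosed K]
    (P₁ P₂ : Set (MvPolynomial (Fin n × Fin n) K)) :
    ∃ S : Set (PrimeSpectrum (MvPolynomial (Fin n × Fin n) K)), IsConstructible S ∧
      zeroSet P₁ * zeroSet P₂ = toSpec ⁻¹' S := by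
  let Q := MvPolynomial ((Fin n × Fin n) ⊕ (Fin n × Fin n)) K
  -- The comorphism of matrix multiplication; Chevalley's theorem is applied to it.
  let ψ : MvPolynomial (Fin n × Fin n) K →ₐ[K] Q :=
    bind₁ fun ij => ∑ k, X (Sum.inl (ij.1, k)) * X (Sum.inr (k, ij.2))
  have hψ : ψ.toRingHom.FinitePresentation := by
    rw [← RingHom.FinitePresentation.of_finiteType]
    refine RingHom.FiniteType.of_comp_finiteType (f := C) ?_
    have : ψ.toRingHom.comp C = algebraMap K Q := ψ.comp_algebraMap
    rw [this, RingHom.finiteType_algebraMap]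
    infer_instance
  let d₁ : Q := (Matrix.of fun i j => (X (Sum.inl (i, j)) : Q)).det
  let d₂ : Q := (Matrix.of fun i j => (X (Sum.inr (i, j)) : Q)).det
  let T : Set (PrimeSpectrum Q) :=
    PrimeSpectrum.zeroLocus (rename Sum.inl '' P₁ ∪ rename Sum.inr '' P₂) \
      PrimeSpectrum.zeroLocus {d₁ * d₂}
  have hd₁ : ∀ x : (Fin n × Fin n) ⊕ (Fin n × Fin n) → K,
      eval x d₁ = (Matrix.of fun i j => x (Sum.inl (i, j))).det := by
    intro x
    simp only [d₁, RingHom.map_det]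
    congr 1
    ext i j
    simp
  have hd₂ : ∀ x : (Fin n × Fin n) ⊕ (Fin n × Fin n) → K,
      eval x d₂ = (Matrix.of fun i j => x (Sum.inr (i, j))).det := by
    intro x
    simp only [d₂, RingHom.map_det]
    congr 1
    ext i j
    simp
  have hT : IsConstructible T := by
    have hc : ∀ s : Set Q, IsConstructible (PrimeSpectrum.zeroLocus s) := by
      intro s
      rw [← isConstructible_compl]
      exact (NoetherianSpace.isCompact _).isConstructible
        (PrimeSpectrum.isClosed_zeroLocus s).isOpen_compl
    exact (hc _).sdiff (hc _)
  refine ⟨_, PrimeSpectrum.isConstructible_comap_image hψ hT, ?_⟩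
  ext g
  constructor
  · rintro ⟨g₁, h₁, g₂, h₂, rfl⟩
    let x : (Fin n × Fin n) ⊕ (Fin n × Fin n) → K := Sum.elim (coords g₁) (coords g₂)
    refine ⟨⟨RingHom.ker (eval x), RingHom.ker_isPrime _⟩, ⟨?_, ?_⟩, ?_⟩
    · rintro _ (⟨p, hp, rfl⟩ | ⟨p, hp, rfl⟩)
      · change eval x (rename Sum.inl p) = 0
        rw [eval_rename]
        exact h₁ p hp
      · change eval x (rename Sum.inr p) = 0
        rw [eval_rename]
        exact h₂ p hp
    · intro h
      have h0 : eval x (d₁ * d₂) = 0 := h rfl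
      rw [map_mul, hd₁, hd₂] at h0
      exact mul_ne_zero g₁.det.ne_zero g₂.det.ne_zero h0
    · ext p
      change eval x (ψ p) = 0 ↔ eval (coords (g₁ * g₂)) p = 0
      have : coords (g₁ * g₂) = fun ij =>
          eval x (∑ k, X (Sum.inl (ij.1, k)) * X (Sum.inr (k, ij.2))) := by
        ext ij
        simp [coords, x, Matrix.mul_apply]
      rw [this]
      exact iff_of_eq (congrArg (· = 0) (eval₂Hom_bind₁ _ _ _ _))
  · rintro ⟨q, ⟨hq, hqd⟩, hqg⟩
    have hd : d₁ * d₂ ∉ q.asIdeal := fun h => hqd (by simpa [PrimeSpectrum.mem_zeroLocus] using h)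
    -- The prime `q` over `g` need not be a `K`-point. The Nullstellensatz supplies a zero `x` of
    -- `q` with both determinants nonzero; it still lies over `g`, since `q` contains the images
    -- under `ψ` of all `X ij - C (coords g ij)`.
    rw [← IsPrime.vanishingIdeal_zeroLocus (K := K) q.asIdeal, mem_vanishingIdeal_iff] at hd
    push Not at hd
    obtain ⟨x, hx, hxd⟩ := hd
    rw [aeval_eq_eval, map_mul, hd₁, hd₂] at hxd
    have hx' : ∀ p ∈ q.asIdeal, eval x p = 0 := fun p hp => by
      simpa [aeval_eq_eval] using hx p hp
    let g₁ := Matrix.GeneralLinearGroup.mkOfDetNeZero _ (left_ne_zero_of_mul hxd)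
    let g₂ := Matrix.GeneralLinearGroup.mkOfDetNeZero _ (right_ne_zero_of_mul hxd)
    refine ⟨g₁, fun p hp => ?_, g₂, fun p hp => ?_, coords_injective (funext fun ij => ?_)⟩
    · have := hx' _ (hq (Or.inl ⟨p, hp, rfl⟩))
      rwa [eval_rename] at this
    · have := hx' _ (hq (Or.inr ⟨p, hp, rfl⟩))
      rwa [eval_rename] at this
    · have h1 : X ij - C (coords g ij) ∈ (PrimeSpectrum.comap ψ.toRingHom q).asIdeal := by
        rw [hqg, mem_toSpec]
        simp
      have h2 := hx' _ h1
      have h3 : ψ (X ij - C (coords g ij)) =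
          ∑ k, X (Sum.inl (ij.1, k)) * X (Sum.inr (k, ij.2)) - C (coords g ij) := by
        rw [map_sub, bind₁_X_right, algHom_C, algebraMap_eq]
      change eval x (ψ (X ij - C (coords g ij))) = 0 at h2
      rw [h3] at h2
      rw [map_sub, map_sum, eval_C, sub_eq_zero] at h2
      rw [← h2]
      simp only [map_mul, eval_X]
      exact Matrix.mul_apply

/-- The product of two commuting closed subgroups contains every irreducible subgroup in which it
is dense. -/
theorem exists_mul_eq_of_dense [IsAlgClosed K] {G H₁ H₂ : Subgroup (GL (Fin n) K)}
    (hG : IsIrreducible (G : Set (GL (Fin n) K)))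
    (h₁ : IsClosed (H₁ : Set (GL (Fin n) K))) (h₂ : IsClosed (H₂ : Set (GL (Fin n) K)))
    (hle₁ : H₁ ≤ G) (hle₂ : H₂ ≤ G)
    (hcomm : ∀ a ∈ H₁, ∀ b ∈ H₂, a * b = b * a)
    (hdense : (G : Set (GL (Fin n) K)) ⊆ closure ((H₁ : Set (GL (Fin n) K)) * H₂)) :
    ∀ g ∈ G, ∃ g₁ ∈ H₁, ∃ g₂ ∈ H₂, g₁ * g₂ = g := by
  obtain ⟨P₁, h₁⟩ := isClosed_iff_zeroSet.mp h₁
  obtain ⟨P₂, h₂⟩ := isClosed_iff_zeroSet.mp h₂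
  -- Commutation makes `H₁H₂` a subgroup, so containing a nonempty open part of `G` will suffice.
  have hnorm : H₁ ≤ Subgroup.normalizer (H₂ : Set (GL (Fin n) K)) := by
    intro a ha
    rw [Subgroup.mem_normalizer_iff]
    intro b
    have key : ∀ c ∈ H₂, a * c * a⁻¹ = c := fun c hc => by
      rw [hcomm a ha c hc, mul_inv_cancel_right]
    refine ⟨fun hb => (key b hb).symm ▸ hb, fun hb => ?_⟩
    have h := key _ hb
    rw [mul_left_inj, mul_right_inj] at h
    rwa [h] at hb
  have hsup : ((H₁ ⊔ H₂ : Subgroup (GL (Fin n) K)) : Set (GL (Fin n) K)) = H₁ * H₂ :=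
    Subgroup.coe_mul_of_left_le_normalizer_right _ _ hnorm
  obtain ⟨S, hS, hSeq⟩ := exists_isConstructible_mul_eq_preimage P₁ P₂
  obtain ⟨D, rfl⟩ := PrimeSpectrum.exists_constructibleSetData_iff.mpr hS
  have hU : (H₁ : Set (GL (Fin n) K)) * H₂ = ⋃ c ∈ D,
      toSpec ⁻¹' PrimeSpectrum.zeroLocus (range c.g) ∩
        (toSpec ⁻¹' PrimeSpectrum.zeroLocus {c.f})ᶜ := by
    rw [h₁, h₂, hSeq, PrimeSpectrum.ConstructibleSetData.toSet, preimage_iUnion₂]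
    rfl
  have hcl : ∀ s, IsClosed (toSpec (K := K) (n := n) ⁻¹' PrimeSpectrum.zeroLocus s) := fun s =>
    (PrimeSpectrum.isClosed_zeroLocus s).preimage isInducing_toSpec.continuous
  obtain ⟨V, hV, hne, hsub⟩ := hG.exists_isOpen_inter_subset D _ _ (fun c _ => hcl (range c.g))
    (fun c _ => (hcl {c.f}).isOpen_compl)
    (by rw [← hU, ← hsup]; exact sup_le hle₁ hle₂) (by rwa [← hU])
  rw [← hU, ← hsup] at hsub
  intro g hg
  have := Subgroup.le_of_inter_isOpen_subset hG.isPreirreducible hV hne hsub hg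
  rw [← SetLike.mem_coe, hsup] at this
  exact this

/-- An irreducible finite-index subgroup is dense in the connected group `G`, and closures of
irreducible sets are irreducible. -/
theorem IsZariskiConnected.isIrreducible {G : Subgroup (GL (Fin n) K)}
    (hcl : IsClosed (G : Set (GL (Fin n) K))) (hG : IsZariskiConnected G) :
    IsIrreducible (G : Set (GL (Fin n) K)) := by
  obtain ⟨B, hB, hidx, hirr⟩ := G.exists_relIndex_ne_zero_isIrreducible
  have h := Subgroup.closure_eq_of_relIndex_ne_zero hB hidx
    (by rw [hcl.closure_eq]; exact hG.isPreconnected)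
  rw [← hcl.closure_eq, ← h]
  exact hirr.closure

end Zariski

end LinAlgGroup

/-! ### From a presentation of `Γ` to one of `G` -/

theorem Subgroup.infinite_of_relIndex_ne_zero {X : Type*} [Group X] {A B : Subgroup X}
    (hA : (A : Set X).Infinite) (hle : B ≤ A) (h : B.relIndex A ≠ 0) : (B : Set X).Infinite := by
  intro hB
  have hfin : Finite B := hB.to_subtype
  have := (B.subgroupOf A).card_mul_index
  rw [Nat.card_congr (Subgroup.subgroupOfEquivOfLe hle).toEquiv] at this
  have hne : Nat.card A ≠ 0 := this ▸ mul_ne_zero Nat.card_pos.ne' h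
  exact hA (Nat.finite_of_card_ne_zero hne)

theorem mainTheorem5 {k K : Type*} [Field k] [CharZero k] [Field K] [IsAlgClosed K] [Algebra k K]
    {n : ℕ} (G : Subgroup (GL (Fin n) K))
    (hG : LinAlgGroup.IsAlgebraicGroup k G)
    (hconn : LinAlgGroup.IsZariskiConnected G)
    (hdim : 0 < LinAlgGroup.dim G)
    (hnot : ¬ LinAlgGroup.IsPresentableByProduct k G)
    (Γ : Subgroup (GL (Fin n) K))
    (hΓ : Γ ≤ LinAlgGroup.points k G)
    (hdense : LinAlgGroup.zariskiClosure (Γ : Set (GL (Fin n) K)) = (G : Set (GL (Fin n) K))) :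
    ¬ GroupPresentableByProduct Γ := by
  rintro ⟨Γ₁, _, Γ₂, _, φ, hinf₁, hinf₂, hidx⟩
  let := LinAlgGroup.zariskiTopology K n
  have hGcl : IsClosed (G : Set (GL (Fin n) K)) := hG.isZariskiClosed
  have hdense' : closure (Γ : Set (GL (Fin n) K)) = G := hdense
  let f : Γ₁ × Γ₂ →* GL (Fin n) K := Γ.subtype.comp φ
  let a : Γ₁ →* GL (Fin n) K := f.comp (MonoidHom.inl Γ₁ Γ₂)
  let b : Γ₂ →* GL (Fin n) K := f.comp (MonoidHom.inr Γ₁ Γ₂)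
  have hainf : (a.range : Set (GL (Fin n) K)).Infinite := by
    refine (hinf₁.image Subtype.val_injective.injOn).mono ?_
    rintro _ ⟨_, ⟨x, rfl⟩, rfl⟩
    exact ⟨x, rfl⟩
  have hbinf : (b.range : Set (GL (Fin n) K)).Infinite := by
    refine (hinf₂.image Subtype.val_injective.injOn).mono ?_
    rintro _ ⟨_, ⟨y, rfl⟩, rfl⟩
    exact ⟨y, rfl⟩
  have haΓ : a.range ≤ Γ := by
    rintro _ ⟨x, rfl⟩
    exact (φ (x, 1)).2
  have hbΓ : b.range ≤ Γ := by
    rintro _ ⟨y, rfl⟩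
    exact (φ (1, y)).2
  have hab : ∀ x ∈ a.range, ∀ y ∈ b.range, x * y = y * x := by
    rintro _ ⟨x, rfl⟩ _ ⟨y, rfl⟩
    change f (x, 1) * f (1, y) = f (1, y) * f (x, 1)
    rw [← map_mul, ← map_mul]
    simp
  obtain ⟨A, hAle, hAidx, hAirr⟩ := a.range.exists_relIndex_ne_zero_isIrreducible
  obtain ⟨B, hBle, hBidx, hBirr⟩ := b.range.exists_relIndex_ne_zero_isIrreducible
  have hkey : ∀ C : Subgroup (GL (Fin n) K), C ≤ Γ → IsIrreducible (C : Set (GL (Fin n) K)) →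
      (C : Set (GL (Fin n) K)).Infinite → C.noetherianClosure ≤ G ∧
        LinAlgGroup.IsAlgebraicGroup k C.noetherianClosure ∧
        LinAlgGroup.IsZariskiConnected C.noetherianClosure ∧
        0 < LinAlgGroup.dim C.noetherianClosure := by
    intro C hCΓ hirr hinf
    have hirr' : IsIrreducible (C.noetherianClosure : Set (GL (Fin n) K)) := hirr.closure
    refine ⟨closure_minimal (fun x hx => (hΓ (hCΓ hx)).1) hGcl, ⟨isClosed_closure, ?_⟩,
      hirr'.isConnected, LinAlgGroup.dim_pos hirr' (hinf.mono C.le_noetherianClosure)⟩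
    exact LinAlgGroup.isDefinedOver_closure fun x hx => (hΓ (hCΓ hx)).2
  obtain ⟨hA₁, hA₂, hA₃, hA₄⟩ := hkey A (hAle.trans haΓ) hAirr
    (Subgroup.infinite_of_relIndex_ne_zero hainf hAle hAidx)
  obtain ⟨hB₁, hB₂, hB₃, hB₄⟩ := hkey B (hBle.trans hbΓ) hBirr
    (Subgroup.infinite_of_relIndex_ne_zero hbinf hBle hBidx)
  have hcomm : ∀ x ∈ A.noetherianClosure, ∀ y ∈ B.noetherianClosure, x * y = y * x :=
    LinAlgGroup.commute_of_mem_closure fun x hx y hy => hab x (hAle hx) y (hBle hy)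
  refine hnot ⟨A.noetherianClosure, B.noetherianClosure, hA₁, hB₁, hA₂, hB₂, hA₃, hB₃, hA₄, hB₄,
    hcomm, LinAlgGroup.exists_mul_eq_of_dense (hconn.isIrreducible hGcl) isClosed_closure
      isClosed_closure hA₁ hB₁ hcomm ?_⟩
  -- `φ` maps `N` onto a finite-index subgroup of `Γ` contained in `AB`, so the product of the
  -- closures is dense in `G`.
  let N : Subgroup (Γ₁ × Γ₂) := (A.comap a).prod (B.comap b)
  have hN : (N.map φ).index ≠ 0 := by
    rw [Subgroup.index_map]
    refine mul_ne_zero ?_ hidx.index_ne_zero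
    have hNidx : N.index ≠ 0 := by
      rw [Subgroup.index_prod, Subgroup.index_comap, Subgroup.index_comap]
      exact mul_ne_zero hAidx hBidx
    exact fun h => hNidx (Nat.eq_zero_of_zero_dvd (h ▸ Subgroup.index_dvd_of_le le_sup_left))
  have hL : ((N.map φ).map Γ.subtype).relIndex Γ ≠ 0 := by
    rwa [Subgroup.relIndex, Subgroup.subgroupOf,
      Subgroup.comap_map_eq_self_of_injective Γ.subtype_injective]
  have hLcl := Subgroup.closure_eq_of_relIndex_ne_zero (Subgroup.map_subtype_le _) hL
    (by rw [hdense']; exact hconn.isPreconnected)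
  rw [← hdense', ← hLcl]
  refine closure_mono ?_
  rintro _ ⟨_, ⟨⟨x, y⟩, ⟨hx, hy⟩, rfl⟩, rfl⟩
  refine ⟨a x, A.le_noetherianClosure hx, b y, B.le_noetherianClosure hy, ?_⟩
  change f (x, 1) * f (1, y) = f (x, y)
  rw [← map_mul]
  simp
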